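/- Let $n\ge 1$, and let $a,b$ be integers with $a+b=0$ or $a+b=1$. Let $K_n^{ab}$ be the integral gain graph on $[n]=\{1,\dots,n\}$ having, for all $1\le i<j\le n$ and every integer $g$ with $a\le g\le b$, exactly one edge from $i$ to $j$ with gain $g$, and let $\mathcal A=\mathcal A[K_n^{ab}]$ be the arrangement of all the hyperplanes $x_j-x_i=g$ ($1\le i<j\le n$, $a\le g\le b$) in $\mathbb R^n$. Let $\mathcal A_0$ be the arrangement that $\mathcal A$ induces on the $(n-1)$-dimensional space $V_{n-1}=\{x\in\mathbb R^n : x_1+\dots+x_n=0\}$. The characteristic polynomial of a finite arrangement is $\chi(q)=\sum_z\mu(\hat 0,z)\,q^{\dim z}$, the sum being over all nonempty intersections $z$ of hyperplanes of the arrangement (including the whole space $\hat 0$), ordered by reverse inclusion, with Möbius function $\mu$. For integers $\alpha,\beta$, an $(\alpha,\beta)$-rooted labelled forest with $n$ vertices is a disjoint union of rooted trees with total vertex set $[n]$, each edge of which, with parent $i$ and child $j$, is weighted with an integer from $[1,\alpha]$ if $i<j$ and from $[1,\beta]$ if $i>j$ (these intervals being empty if $\alpha\le 0$, respectively $\beta\le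 0$). Let $f_{n,j}$ be the number of $(1-a,b)$-rooted labelled forests with $n$ vertices and $j$ trees, and let $$F_{n,1-a,b}(q)=\sum_{j=1}^{n}(-1)^{n-j}f_{n,j}\,q^{j-1}.$$ Then $$\chi_{\mathcal A_0}(q)=F_{n,1-a,b}(q)\qquad\text{and}\qquad \chi_{\mathcal A}(q)=q\,F_{n,1-a,b}(q).$$ -/

import Mathlib

open Polynomial

/-! ### Affine hyperplane arrangements -/

section Arrangement

variable {V : Type*} [AddCommGroup V] [Module ℝ V]

open Classical in
/-- The nonempty intersections of members of a finite family `A` of affine subspaces; the empty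
intersection, i.e. the whole space `⊤`, is included (`⊥` is the empty affine subspace). -/
noncomputable def flats (A : Finset (AffineSubspace ℝ V)) : Finset (AffineSubspace ℝ V) :=
  (A.powerset.image fun B => B.inf id).filter fun z => z ≠ ⊥

/-- The intersection poset, ordered by reverse inclusion. -/
abbrev IntersectionPoset (A : Finset (AffineSubspace ℝ V)) : Type _ :=
  {z : AffineSubspace ℝ V // z ∈ flats A}ᵒᵈ

open Classical in
noncomputable instance instLocallyFiniteOrderIntersectionPoset (A : Finset (AffineSubspace ℝ V)) :
    LocallyFiniteOrder (IntersectionPoset A) :=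
  Fintype.toLocallyFiniteOrder

theorem top_mem_flats (A : Finset (AffineSubspace ℝ V)) : ⊤ ∈ flats A := by
  classical
  refine Finset.mem_filter.2 ⟨Finset.mem_image.2 ⟨∅, by simp, by simp⟩, ?_⟩
  exact top_ne_bot

/-- The least element of the intersection poset: the whole space. -/
def wholeSpace (A : Finset (AffineSubspace ℝ V)) : IntersectionPoset A :=
  OrderDual.toDual ⟨⊤, top_mem_flats A⟩

open Classical in
/-- The characteristic polynomial `χ_A(q) = ∑_z μ(0̂, z) q ^ dim z` of an arrangement, where `z` runs
over the intersection poset, `μ` is its Möbius function and `0̂` is the whole space. -/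
noncomputable def characteristicPolynomial (A : Finset (AffineSubspace ℝ V)) : ℤ[X] :=
  ∑ z : IntersectionPoset A,
    C (IncidenceAlgebra.mu ℤ (wholeSpace A) z) *
      X ^ Module.finrank ℝ (OrderDual.ofDual z).1.direction

open Classical in
/-- The arrangement induced on a linear subspace `W`. -/
noncomputable def inducedOn (W : Submodule ℝ V) (A : Finset (AffineSubspace ℝ V)) :
    Finset (AffineSubspace ℝ W) :=
  A.image fun H => H.comap W.subtype.toAffineMap

end Arrangement

/-! ### Integral gain graphs and their arrangements -/

/-- An integral gain graph without loops on the vertex set `V` (multiple edges are permitted).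
Every edge is stored in one orientation, from `src e` to `tgt e`, with its gain in that orientation;
in the opposite orientation the gain of the edge is `-gain e`. -/
structure IntegralGainGraph (V E : Type*) where
  src : E → V
  tgt : E → V
  gain : E → ℤ
  src_ne_tgt : ∀ e, src e ≠ tgt e

/-- The affine subspace `x_j - x_i = g` of `ℝⁿ`. -/
def gainHyperplane {n : ℕ} (i j : Fin n) (g : ℤ) : AffineSubspace ℝ (Fin n → ℝ) where
  carrier := {x | x j - x i = g}
  smul_vsub_vadd_mem' := by
    intro c p q r hp hq hr
    simp only [Set.mem_ofPred_eq, vsub_eq_sub, vadd_eq_add, Pi.add_apply, Pi.smul_apply,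
      Pi.sub_apply, smul_eq_mul] at *
    linear_combination c * hp - c * hq + hr

open Classical in
/-- The affinographic arrangement of a gain graph: the hyperplanes `x_j - x_i = g` in `ℝⁿ` for all
edges from `i` to `j` with gain `g`. (Reversing an edge and negating its gain gives the same
hyperplane.) -/
noncomputable def IntegralGainGraph.arrangement {n : ℕ} {E : Type*} [Fintype E]
    (Φ : IntegralGainGraph (Fin n) E) : Finset (AffineSubspace ℝ (Fin n → ℝ)) :=
  Finset.univ.image fun e => gainHyperplane (Φ.src e) (Φ.tgt e) (Φ.gain e)

/-- The gain graph `K_n^{ab}`: for all vertices `i < j` and all integers `a ≤ g ≤ b` there is exactly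
one edge from `i` to `j` with gain `g`. -/
def gainK (n : ℕ) (a b : ℤ) :
    IntegralGainGraph (Fin n) ({p : Fin n × Fin n // p.1 < p.2} × Set.Icc a b) where
  src e := e.1.1.1
  tgt e := e.1.1.2
  gain e := e.2.1
  src_ne_tgt e := e.1.2.ne

/-- The hyperplane `x_1 + ⋯ + x_n = 0` of `ℝⁿ`. -/
def sumZero (n : ℕ) : Submodule ℝ (Fin n → ℝ) where
  carrier := {x | ∑ i, x i = 0}
  add_mem' := by
    intro x y hx hy
    simp only [Set.mem_ofPred_eq, Pi.add_apply, Finset.sum_add_distrib] at *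
    rw [hx, hy, add_zero]
  zero_mem' := by simp
  smul_mem' := by
    intro c x hx
    simp only [Set.mem_ofPred_eq, Pi.smul_apply, smul_eq_mul, ← Finset.mul_sum] at *
    rw [hx, mul_zero]

/-! ### Rooted labelled forests -/

/-- An `(α, β)`-rooted labelled forest on `n` vertices, i.e. a vertex-disjoint union of
`(α, β)`-rooted labelled trees covering the vertex set, given by its parent map: `up v = none` if `v`
is a root, and `up v = some (p, w)` if `p` is the parent of `v` and the edge between them has
weight `w`. An edge from a parent `p` to a child `v` has its weight in `[1, α]` if `p < v` and
in `[1, β]` if `p > v`; an interval `[1, γ]` with `γ ≤ 0` is empty. -/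
@[ext]
structure RootedLabelledForest (n : ℕ) (α β : ℤ) where
  up : Fin n → Option (Fin n × ℤ)
  acyclic : ∀ v, ¬ Relation.TransGen (fun c p => ∃ w, up c = some (p, w)) v v
  weight_of_lt : ∀ v p w, up v = some (p, w) → p < v → w ∈ Set.Icc 1 α
  weight_of_gt : ∀ v p w, up v = some (p, w) → v < p → w ∈ Set.Icc 1 β

/-- The number of trees of a forest, counted by their roots (every tree has exactly one). -/
def RootedLabelledForest.numTrees {n : ℕ} {α β : ℤ} (F : RootedLabelledForest n α β) : ℕ :=
  (Finset.univ.filter fun v => F.up v = none).card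

/-- There are only finitely many such forests. -/
instance instFiniteRootedLabelledForest (n : ℕ) (α β : ℤ) : Finite (RootedLabelledForest n α β) := by
  have hw : ∀ (F : RootedLabelledForest n α β) v p w, F.up v = some (p, w) →
      w ∈ Set.Icc 1 (max α β) := by
    intro F v p w h
    rcases lt_trichotomy p v with h1 | h1 | h1
    · have := F.weight_of_lt v p w h h1
      exact ⟨this.1, this.2.trans (le_max_left _ _)⟩
    · exact absurd (Relation.TransGen.single ⟨w, h1 ▸ h⟩) (F.acyclic v)
    · have := F.weight_of_gt v p w h h1
      exact ⟨this.1, this.2.trans (le_max_right _ _)⟩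
  let S : Set (Option (Fin n × ℤ)) :=
    insert none (some '' (Set.univ ×ˢ Set.Icc 1 (max α β)))
  have hS : S.Finite := ((Set.finite_univ.prod (Set.finite_Icc _ _)).image _).insert _
  have := hS.to_subtype
  have hF : ∀ (F : RootedLabelledForest n α β) v, F.up v ∈ S := by
    intro F v
    rcases h : F.up v with _ | ⟨p, w⟩
    · exact Or.inl rfl
    · exact Or.inr ⟨(p, w), ⟨trivial, hw F v p w h⟩, rfl⟩
  refine Finite.of_injective (β := Fin n → S) (fun F v => ⟨F.up v, hF F v⟩) ?_
  intro F G h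
  ext1
  funext v
  exact congrArg Subtype.val (congrFun h v)

/-- The number `f_{n,j}` of `(α, β)`-rooted labelled forests with `n` vertices and `j` trees. -/
noncomputable def numForests (n : ℕ) (α β : ℤ) (j : ℕ) : ℕ :=
  Nat.card {F : RootedLabelledForest n α β // F.numTrees = j}

/-- `F_{n,α,β}(q) = ∑_j (-1)^{n-j} f_{n,j} q^{j-1}`, where `j` runs over the possible numbers of
trees, `1 ≤ j ≤ n`. -/
noncomputable def forestPolynomial (n : ℕ) (α β : ℤ) : ℤ[X] :=
  ∑ j ∈ Finset.Icc 1 n, C ((-1) ^ (n - j) * (numForests n α β j : ℤ)) * X ^ (j - 1)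

/-! The proof is the finite field method combined with a matrix-tree theorem: both sides, evaluated
at every large integer `q`, equal the same product.

Arrangement side. For large `q`, every labelling `x` of the vertices in `ZMod q` lifts to an integer
labelling satisfying exactly the same edge equations (`exists_int_labelling`), hence to a real
point. The real points obtained in this way meet each flat `z` in `q ^ dim z` points, because both
the solution count and the dimension are governed by the components of the graph of edges defining
`z`. Möbius inversion then makes `χ(q)` the number of labellings violating every edge equation. On
the hyperplane of sum zero the labellings are normalized by `x (Fin.last m) = 0`; translation
invariance accounts for the factor `q` between the two polynomials.

To count normalized labellings when `b ≥ 0`, put `a = 1 - ε - b` with `ε ∈ {0, 1}` and cut the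
circle at the label 0. The remaining labels are integers in an interval, linearly ordered with
prescribed gaps. Removing `b` for every predecessor is a bijection onto arbitrary maps (`ε = 0`) or
injections (`ε = 1`), giving `∏ (q - b n - i ε)` over `1 ≤ i < n`.

Forest side. The signed forest sum is the determinant of `forestMatrix`, by expanding each row over
the choices of a parent; row and column operations give `q ∏ (q - i α - (n - i) β)` over `1 ≤ i <
n`. With `α = b + ε` and `β = b` the factors agree. -/

/-! ### Möbius inversion over the intersection poset -/

section Arrangement

variable {V : Type*} [AddCommGroup V] [Module ℝ V]

theorem mem_inf_id_iff {B : Finset (AffineSubspace ℝ V)} {p : V} :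
    p ∈ B.inf id ↔ ∀ H ∈ B, p ∈ H := by
  classical
  induction B using Finset.induction_on with
  | empty => simp
  | insert H B _ ih => simp [Finset.inf_insert, AffineSubspace.mem_inf_iff, ih]

theorem mem_flats_iff {A : Finset (AffineSubspace ℝ V)} {z : AffineSubspace ℝ V} :
    z ∈ flats A ↔ (∃ B ⊆ A, B.inf id = z) ∧ z ≠ ⊥ := by
  classical
  simp [flats]

open Classical in
/-- The smallest flat through a point. -/
noncomputable def minimalFlat (A : Finset (AffineSubspace ℝ V)) (p : V) : AffineSubspace ℝ V :=
  (A.filter fun H => p ∈ H).inf id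

theorem mem_minimalFlat (A : Finset (AffineSubspace ℝ V)) (p : V) : p ∈ minimalFlat A p := by
  classical
  rw [minimalFlat, mem_inf_id_iff]
  exact fun H hH => (Finset.mem_filter.1 hH).2

theorem minimalFlat_mem_flats (A : Finset (AffineSubspace ℝ V)) (p : V) :
    minimalFlat A p ∈ flats A := by
  classical
  refine mem_flats_iff.2 ⟨⟨_, Finset.filter_subset _ _, rfl⟩, fun h => ?_⟩
  exact AffineSubspace.notMem_bot ℝ V p (h ▸ mem_minimalFlat A p)

theorem minimalFlat_le_iff {A : Finset (AffineSubspace ℝ V)} {z : AffineSubspace ℝ V}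
    (hz : z ∈ flats A) (p : V) : minimalFlat A p ≤ z ↔ p ∈ z := by
  classical
  refine ⟨fun h => h (mem_minimalFlat A p), fun h => ?_⟩
  obtain ⟨⟨B, hB, rfl⟩, -⟩ := mem_flats_iff.1 hz
  rw [mem_inf_id_iff] at h
  exact Finset.inf_mono fun H hH => Finset.mem_filter.2 ⟨hB hH, h H hH⟩

theorem minimalFlat_eq_top_iff {A : Finset (AffineSubspace ℝ V)} (hA : ⊤ ∉ A) (p : V) :
    minimalFlat A p = ⊤ ↔ ∀ H ∈ A, p ∉ H := by
  classical
  constructor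
  · intro h H hH hp
    have hle : minimalFlat A p ≤ H :=
      Finset.inf_le (f := id) (Finset.mem_filter.2 ⟨hH, hp⟩)
    rw [h, top_le_iff] at hle
    exact hA (hle ▸ hH)
  · intro h
    rw [minimalFlat, Finset.filter_false_of_mem h, Finset.inf_empty]

/-- If a finite family of points meets every flat `z` in exactly `q ^ dim z` points, then `χ(q)` is
the number of points that lie on no member of the arrangement. -/
theorem eval_characteristicPolynomial_eq_card {A : Finset (AffineSubspace ℝ V)} (hA : ⊤ ∉ A)
    {ι : Type*} [Finite ι] (pt : ι → V) (q : ℕ)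
    (h : ∀ z ∈ flats A, Nat.card {x // pt x ∈ z} = q ^ Module.finrank ℝ z.direction) :
    (characteristicPolynomial A).eval (q : ℤ) = Nat.card {x // ∀ H ∈ A, pt x ∉ H} := by
  classical
  have := Fintype.ofFinite ι
  let F : ι → IntersectionPoset A := fun x =>
    OrderDual.toDual ⟨minimalFlat A (pt x), minimalFlat_mem_flats A (pt x)⟩
  have hF : ∀ z : IntersectionPoset A, ∀ x, pt x ∈ (OrderDual.ofDual z).1 ↔ z ≤ F x := by
    intro z x
    rw [← minimalFlat_le_iff (OrderDual.ofDual z).2]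
    rfl
  have h0 : ∀ z : IntersectionPoset A, wholeSpace A ≤ z := fun z => le_top (α := AffineSubspace ℝ V)
  have hF0 : ∀ x, wholeSpace A = F x ↔ ∀ H ∈ A, pt x ∉ H := by
    intro x
    rw [← minimalFlat_eq_top_iff hA, eq_comm (a := wholeSpace A)]
    exact Subtype.ext_iff
  have key : ∀ z : IntersectionPoset A,
      ((q : ℤ) ^ Module.finrank ℝ (OrderDual.ofDual z).1.direction) =
        ∑ x : ι, if z ≤ F x then 1 else 0 := by
    intro z
    rw [Finset.sum_boole, ← Nat.cast_pow, ← h _ (OrderDual.ofDual z).2, Nat.card_eq_fintype_card,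
      Fintype.card_subtype]
    simp only [hF]
  rw [characteristicPolynomial, eval_finsetSum]
  simp only [eval_mul, eval_C, eval_pow, eval_X, key, Finset.mul_sum, mul_ite, mul_one, mul_zero]
  -- After exchanging the sums, the point `x` contributes the sum of `μ(0̂, z)` over `0̂ ≤ z ≤ F x`,
  -- which is 1 if `F x = 0̂` and 0 otherwise.
  rw [Finset.sum_comm, Nat.card_eq_fintype_card, Fintype.card_subtype, ← Finset.sum_boole]
  refine Finset.sum_congr rfl fun x _ => ?_
  rw [← Finset.sum_filter]
  simp only [← hF0 x]
  rw [← IncidenceAlgebra.sum_Icc_mu_right]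
  refine Finset.sum_congr ?_ fun _ _ => rfl
  ext z
  simp [h0]

end Arrangement

/-! ### Determinants of parent maps and of the forest matrix -/

section Determinants

open Matrix

/-- A matrix all of whose off-diagonal entries in a term of the Leibniz expansion are steps of an
acyclic relation has the determinant of its diagonal. -/
theorem det_eq_prod_diag_of_acyclic {ι R : Type*} [Fintype ι] [DecidableEq ι] [CommRing R]
    (M : Matrix ι ι R) (r : ι → ι → Prop) (hr : ∀ v, ¬ Relation.TransGen r v v)
    (hM : ∀ u v, u ≠ v → M u v ≠ 0 → r u v) : M.det = ∏ v, M v v := by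
  rw [← det_transpose, det_apply, Finset.sum_eq_single 1]
  · simp
  · intro σ _ hσ
    obtain ⟨v, hv⟩ : ∃ v, σ v ≠ v := by
      by_contra! h
      exact hσ (Equiv.ext h)
    suffices h : ∃ w, M w (σ w) = 0 by
      obtain ⟨w, hw⟩ := h
      rw [Finset.prod_eq_zero (Finset.mem_univ w) (by simpa using hw), smul_zero]
    by_contra! h
    -- If no factor of the term of `σ` vanishes, the orbit of a moved point is a closed walk along
    -- `r`.
    have hstep : ∀ k : ℕ, r ((σ ^ k) v) ((σ ^ (k + 1)) v) := by
      intro k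
      have h1 : (σ ^ (k + 1)) v = σ ((σ ^ k) v) := by rw [pow_succ', Equiv.Perm.mul_apply]
      have h2 : (σ ^ (k + 1)) v = (σ ^ k) (σ v) := by rw [pow_succ, Equiv.Perm.mul_apply]
      refine hM _ _ ?_ (h1 ▸ h _)
      rw [h2]
      exact fun h3 => hv ((σ ^ k).injective h3).symm
    have hgen : ∀ k : ℕ, Relation.TransGen r v ((σ ^ (k + 1)) v) := by
      intro k
      induction k with
      | zero => exact .single (hstep 0)
      | succ k ih => exact ih.tail (hstep _)
    obtain ⟨k, hk⟩ := Nat.exists_eq_succ_of_ne_zero (orderOf_pos σ).ne'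
    have := hgen k
    rw [← Nat.succ_eq_add_one, ← hk, pow_orderOf_eq_one] at this
    exact hr v this
  · simp

variable {n : ℕ}

/-- The row contributed to the forest determinant by the choice `o` of a parent of `v`. -/
def parentRow {R : Type*} [CommRing R] (q : R) (v : Fin n) (o : Option (Fin n × ℤ)) : Fin n → R :=
  o.elim (Pi.single v q) fun p => Pi.single p.1 1 - Pi.single v 1

/-- The step from a vertex to its parent. -/
abbrev ParentStep (up : Fin n → Option (Fin n × ℤ)) (c p : Fin n) : Prop := ∃ w, up c = some (p, w)

theorem det_parentRow_of_acyclic {R : Type*} [CommRing R] (q : R)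
    (up : Fin n → Option (Fin n × ℤ))
    (h : ∀ v, ¬ Relation.TransGen (ParentStep up) v v) :
    (Matrix.of fun v => parentRow q v (up v)).det =
      (-1) ^ (n - (Finset.univ.filter fun v => up v = none).card) *
        q ^ (Finset.univ.filter fun v => up v = none).card := by
  classical
  rw [det_eq_prod_diag_of_acyclic _ (ParentStep up) h]
  · have : ∀ v, (Matrix.of fun v => parentRow q v (up v)) v v =
        if up v = none then q else -1 := by
      intro v
      rcases hv : up v with _ | ⟨p, w⟩
      · simp [parentRow, hv]
      · have hpv : v ≠ p := by
          rintro rfl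
          exact h _ (.single ⟨w, hv⟩)
        simp [parentRow, hv, hpv]
    simp only [this, Finset.prod_ite, Finset.prod_const]
    rw [mul_comm, ← Finset.compl_filter, Finset.card_compl, Fintype.card_fin]
  · intro u v huv hne
    rcases hu : up u with _ | ⟨p, w⟩
    · simp [parentRow, hu, huv.symm] at hne
    · by_cases hp : v = p
      · exact ⟨w, hp ▸ hu⟩
      · simp [parentRow, hu, huv.symm, hp] at hne

/-- The indicator of the vertices that lead to `v` is a kernel vector: a root never leads to `v`,
and any other vertex does so exactly when its parent does. The cycle matters when the parent is `v`
itself, and makes the vector nonzero. -/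
theorem det_parentRow_of_cyclic {R : Type*} [CommRing R] [IsDomain R] (q : R)
    (up : Fin n → Option (Fin n × ℤ)) (v : Fin n) (h : Relation.TransGen (ParentStep up) v v) :
    (Matrix.of fun v => parentRow q v (up v)).det = 0 := by
  classical
  rw [← exists_mulVec_eq_zero_iff]
  refine ⟨fun u => if Relation.TransGen (ParentStep up) u v then 1 else 0, ?_, ?_⟩
  · intro h0
    simpa [h] using congrFun h0 v
  · ext u
    rcases hu : up u with _ | ⟨p, w⟩
    · have : ¬ Relation.TransGen (ParentStep up) u v := by
        intro hT
        obtain ⟨c, ⟨w, hc⟩, -⟩ := Relation.TransGen.head'_iff.1 hT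
        simp [hu] at hc
      simp [mulVec, parentRow, hu, this]
    · have : Relation.TransGen (ParentStep up) u v ↔ Relation.TransGen (ParentStep up) p v := by
        constructor
        · intro hT
          obtain ⟨c, ⟨w', hc⟩, hcv⟩ := Relation.TransGen.head'_iff.1 hT
          rw [hu] at hc
          obtain rfl : p = c := by simpa using congrArg (Option.map Prod.fst) hc
          rcases Relation.reflTransGen_iff_eq_or_transGen.1 hcv with rfl | h'
          · exact h
          · exact h'
        · exact .head ⟨w, hu⟩
      change (parentRow q u (up u)) ⬝ᵥ _ = 0
      rw [hu, parentRow, Option.elim_some, sub_dotProduct]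
      simp [this]

/-- The matrix whose determinant enumerates forests: the rows sum to `q`, and the entries to the
left and to the right of the diagonal are `s` and `t`. -/
def forestMatrix {R : Type*} [CommRing R] (n : ℕ) (q s t : R) : Matrix (Fin n) (Fin n) R :=
  Matrix.of fun v p => if p < v then s else if v < p then t else
    q - v * s - (n - 1 - v : R) * t

theorem sum_forestMatrix_zero {R : Type*} [CommRing R] (m : ℕ) (q s t : R) :
    ∑ p, forestMatrix (m + 1) q s t 0 p = q := by
  rw [Fin.sum_univ_succ]
  simp [forestMatrix]

theorem det_forestMatrix {R : Type*} [CommRing R] (m : ℕ) (q s t : R) :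
    (forestMatrix (m + 1) q s t).det =
      q * ∏ i : Fin m, (q - (i + 1 : R) * s - (m - i : R) * t) := by
  set d : Fin m → R := fun i => q - (i + 1 : R) * s - (m - i : R) * t with hd
  -- Subtracting from each row its predecessor leaves `d i` times a difference of adjacent unit
  -- vectors. Multiplying by the unitriangular `U` replaces entries by tail sums of the row, so `B *
  -- U` is upper triangular with diagonal `q, d 0, d 1, …`.
  let B : Matrix (Fin (m + 1)) (Fin (m + 1)) R := Matrix.of <| Fin.cons
    (forestMatrix (m + 1) q s t 0) fun i => d i • (Pi.single i.succ 1 - Pi.single i.castSucc 1)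
  let U : Matrix (Fin (m + 1)) (Fin (m + 1)) R := Matrix.of fun k j => if j ≤ k then 1 else 0
  have hB : (forestMatrix (m + 1) q s t).det = B.det := by
    refine det_eq_of_forall_row_eq_smul_add_pred (fun _ => 1) (fun j => rfl) fun i j => ?_
    simp only [forestMatrix, B, of_apply, Fin.cons_succ, Pi.smul_apply, Pi.sub_apply, smul_eq_mul,
      Pi.single_apply, hd, Fin.lt_def, Fin.ext_iff, Fin.val_succ, Fin.val_castSucc]
    rcases lt_trichotomy (j : ℕ) i with h | h | h
    · simp [h, h.ne, show (j : ℕ) < i + 1 by omega, show (j : ℕ) ≠ i + 1 by omega]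
    · simp [h]
      ring
    · rcases (show (i : ℕ) + 1 ≤ j from h).eq_or_lt with h' | h'
      · simp [← h']
        ring
      · simp [h, h', h.ne', h'.ne', show ¬ (j : ℕ) < i + 1 by omega, show ¬ (j : ℕ) < i by omega]
  have hU : U.det = 1 := by
    rw [det_of_isLowerTriangular]
    · simp [U]
    · intro i j hij
      have : i < j := hij
      simp [U, this.not_ge]
  have hBU : (B * U).det = q * ∏ i, d i := by
    have hsucc : ∀ (i : Fin m) j, (B * U) i.succ j = if j = i.succ then d i else 0 := by
      intro i j
      have : (B * U) i.succ j = d i * (U i.succ j - U i.castSucc j) := by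
        simp [Matrix.mul_apply, B, mul_sub, sub_mul, Pi.single_apply]
      rw [this]
      simp only [U, of_apply, Fin.le_def, Fin.ext_iff, Fin.val_succ, Fin.val_castSucc]
      rcases lt_trichotomy (j : ℕ) (i + 1) with h | h | h
      · simp [h.le, h.ne, show (j : ℕ) ≤ i by omega]
      · simp [h]
      · simp [h.not_ge, h.ne', show ¬ (j : ℕ) ≤ i by omega]
    rw [det_of_isUpperTriangular, Fin.prod_univ_succ]
    · congr 1
      · simp [Matrix.mul_apply, B, U, sum_forestMatrix_zero]
      · simp [hsucc]
    · intro i j hij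
      have hij : j < i := hij
      obtain ⟨k, rfl⟩ := Fin.exists_succ_eq.2 (Fin.ne_zero_of_lt hij)
      rw [hsucc, if_neg hij.ne]
  rw [hB, ← hBU, det_mul, hU, mul_one]

end Determinants

/-! ### The matrix-tree theorem and the product formula -/

section Forests

variable {n : ℕ} {α β : ℤ}

/-- The possible values of the parent map of a forest at a vertex. -/
noncomputable def parentChoices (n : ℕ) (α β : ℤ) (v : Fin n) : Finset (Option (Fin n × ℤ)) :=
  Finset.insertNone
    ((Finset.univ.filter (· < v) ×ˢ Finset.Icc 1 α).disjUnion
      (Finset.univ.filter (v < ·) ×ˢ Finset.Icc 1 β)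
      (Finset.disjoint_product.2 <| Or.inl <| Finset.disjoint_filter.2 fun _ _ h => h.not_gt))

/-- Each smaller vertex is a possible parent in `α.toNat` ways and each larger one in `β.toNat`
ways; every such choice also puts -1 on the diagonal. Using `toNat` covers the empty weight
intervals. -/
theorem sum_parentRow {R : Type*} [CommRing R] (q : R) (v : Fin n) :
    ∑ o ∈ parentChoices n α β v, parentRow q v o =
      forestMatrix n q (α.toNat : R) (β.toNat : R) v := by
  classical
  rw [parentChoices, Finset.sum_insertNone, Finset.sum_disjUnion, Finset.sum_product,
    Finset.sum_product]
  simp only [parentRow, Option.elim_none, Option.elim_some, Finset.sum_const, Int.card_Icc,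
    add_sub_cancel_right]
  ext p
  simp only [Pi.add_apply, Finset.sum_apply, Pi.sub_apply, nsmul_eq_mul, mul_sub,
    Finset.sum_sub_distrib, Pi.single_apply, forestMatrix, Matrix.of_apply, Pi.mul_apply,
    Pi.natCast_apply]
  rcases lt_trichotomy p v with h | rfl | h
  · simp [h, h.ne, h.not_gt]
  · have h1 : (Finset.univ.filter (· < p)).card = p := by
      rw [Finset.filter_gt_eq_Iio, Fin.card_Iio]
    have h2 : ((Finset.univ.filter (p < ·)).card : R) = n - 1 - p := by
      rw [Finset.filter_lt_eq_Ioi, Fin.card_Ioi, Nat.sub_sub, Nat.cast_sub (by omega)]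
      push_cast
      ring
    simp [h1, h2]
    ring
  · simp [h, h.ne', h.not_gt]

theorem RootedLabelledForest.up_mem (F : RootedLabelledForest n α β) (v : Fin n) :
    F.up v ∈ parentChoices n α β v := by
  rcases h : F.up v with _ | ⟨p, w⟩
  · simp [parentChoices]
  · rcases lt_trichotomy p v with h1 | rfl | h1
    · have := F.weight_of_lt v p w h h1
      simpa [parentChoices, h1, h1.not_gt] using this
    · exact absurd (.single ⟨w, h⟩) (F.acyclic p)
    · have := F.weight_of_gt v p w h h1
      simpa [parentChoices, h1, h1.not_gt] using this

/-- A parent map with admissible values and without cycles is a forest. -/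
def RootedLabelledForest.ofChoices (up : Fin n → Option (Fin n × ℤ))
    (hup : ∀ v, up v ∈ parentChoices n α β v)
    (h : ∀ v, ¬ Relation.TransGen (ParentStep up) v v) : RootedLabelledForest n α β where
  up := up
  acyclic := h
  weight_of_lt v p w hv hp := by
    have := hup v
    rw [hv] at this
    simpa [parentChoices, hp, hp.not_gt] using this
  weight_of_gt v p w hv hp := by
    have := hup v
    rw [hv] at this
    simpa [parentChoices, hp, hp.not_gt] using this

/-- The matrix-tree theorem for rooted labelled forests. -/
theorem sum_forests_eq_det {R : Type*} [CommRing R] [IsDomain R]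
    [Fintype (RootedLabelledForest n α β)] (q : R) :
    ∑ F : RootedLabelledForest n α β, (-1) ^ (n - F.numTrees) * q ^ F.numTrees =
      (forestMatrix n q (α.toNat : R) (β.toNat : R)).det := by
  classical
  have h1 : forestMatrix n q (α.toNat : R) (β.toNat : R) =
      fun v => ∑ o ∈ parentChoices n α β v, parentRow q v o :=
    funext fun v => (sum_parentRow q v).symm
  have h2 := (Matrix.detRowAlternating (n := Fin n) (R := R)).toMultilinearMap.map_sum_finset
    (fun v o => parentRow q v o) (parentChoices n α β)
  rw [h1]
  refine Eq.trans ?_ h2.symm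
  have h3 : ∀ up ∈ Fintype.piFinset (parentChoices n α β),
      (Matrix.detRowAlternating (n := Fin n) (R := R)).toMultilinearMap
        (fun v => parentRow q v (up v)) ≠ 0 →
      ∀ v, ¬ Relation.TransGen (ParentStep up) v v :=
    fun up _ hne v hv => hne (det_parentRow_of_cyclic q up v hv)
  -- Cyclic parent maps contribute zero, so only forests survive in the multilinear expansion.
  rw [← Finset.sum_filter_of_ne h3]
  refine Finset.sum_bij' (fun F _ => F.up)
    (fun up h => .ofChoices up (Fintype.mem_piFinset.1 (Finset.mem_filter.1 h).1)
      (Finset.mem_filter.1 h).2) ?_ ?_ ?_ ?_ ?_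
  · intro F _
    exact Finset.mem_filter.2 ⟨Fintype.mem_piFinset.2 F.up_mem, F.acyclic⟩
  · exact fun _ _ => Finset.mem_univ _
  · exact fun F _ => rfl
  · exact fun up _ => rfl
  · exact fun F _ => (det_parentRow_of_acyclic q F.up F.acyclic).symm

theorem RootedLabelledForest.one_le_numTrees (hn : 1 ≤ n) (F : RootedLabelledForest n α β) :
    1 ≤ F.numTrees := by
  have : Nonempty (Fin n) := ⟨⟨0, hn⟩⟩
  let r : Fin n → Fin n → Prop := fun p c => Relation.TransGen (ParentStep F.up) c p
  have : IsTrans (Fin n) r := ⟨fun _ _ _ h1 h2 => h2.trans h1⟩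
  have : Std.Irrefl r := ⟨F.acyclic⟩
  -- A vertex without ancestors is a root.
  obtain ⟨v, -, hv⟩ := (Finite.wellFounded_of_trans_of_irrefl r).has_min Set.univ Set.univ_nonempty
  refine Finset.card_pos.2 ⟨v, Finset.mem_filter.2 ⟨Finset.mem_univ _, ?_⟩⟩
  rcases h : F.up v with _ | ⟨p, w⟩
  · rfl
  · exact absurd (.single ⟨w, h⟩) (hv p trivial)

theorem RootedLabelledForest.numTrees_le (F : RootedLabelledForest n α β) : F.numTrees ≤ n :=
  (Finset.card_le_univ _).trans_eq (Fintype.card_fin n)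

theorem X_mul_forestPolynomial_eq_det (hn : 1 ≤ n) :
    X * forestPolynomial n α β = (forestMatrix n (X : ℤ[X]) (α.toNat : ℤ[X]) (β.toNat : ℤ[X])).det := by
  classical
  have := Fintype.ofFinite (RootedLabelledForest n α β)
  rw [← sum_forests_eq_det, ← Finset.sum_fiberwise_of_maps_to (t := Finset.Icc 1 n)
    (g := RootedLabelledForest.numTrees)
    fun F _ => Finset.mem_Icc.2 ⟨F.one_le_numTrees hn, F.numTrees_le⟩, forestPolynomial,
    Finset.mul_sum]
  refine Finset.sum_congr rfl fun j hj => ?_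
  rw [Finset.sum_congr rfl fun F hF => by rw [(Finset.mem_filter.1 hF).2], Finset.sum_const,
    ← Fintype.card_subtype, ← Nat.card_eq_fintype_card, ← numForests]
  obtain ⟨k, rfl⟩ := Nat.exists_eq_add_of_le' (Finset.mem_Icc.1 hj).1
  simp only [Nat.add_sub_cancel, map_mul, map_pow, map_neg, map_one, nsmul_eq_mul, map_natCast,
    pow_succ]
  ring

/-- The product formula for the forest polynomial, evaluated at `q`. -/
theorem eval_forestPolynomial (m : ℕ) (q : ℤ) (hq : q ≠ 0) :
    (forestPolynomial (m + 1) α β).eval q =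
      ∏ i : Fin m, (q - (i + 1 : ℤ) * α.toNat - (m - i : ℤ) * β.toNat) := by
  have h := congrArg (eval q) (X_mul_forestPolynomial_eq_det (α := α) (β := β) (Nat.succ_pos m))
  rw [det_forestMatrix, eval_mul, eval_mul, eval_X] at h
  rw [mul_left_cancel₀ hq h, eval_prod]
  simp

end Forests

/-! ### Counting separated integer families -/

section Count

/-- `u` is separated with parameters `b` and `ε`: for `i < j`, the differences `u j - u i` avoid
`[1 - ε - b, b]`. -/
def Separated {m : ℕ} (b ε : ℤ) (u : Fin m → ℤ) : Prop :=
  ∀ i j, i < j → b + 1 ≤ u j - u i ∨ b + ε ≤ u i - u j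

/-- The least admissible value of `u i - u k` (apart from `b`) when `k` precedes `i`. -/
def stepGap {m : ℕ} (ε : ℤ) (k i : Fin m) : ℤ := if k < i then 1 else ε

/-- `k` precedes `i` in the linear order determined by `u`. -/
def Precedes {m : ℕ} (ε : ℤ) (u : Fin m → ℤ) (k i : Fin m) : Prop :=
  k ≠ i ∧ stepGap ε k i ≤ u i - u k

open Classical in
/-- The number of indices that precede `i`. -/
noncomputable def rankOf {m : ℕ} (ε : ℤ) (u : Fin m → ℤ) (i : Fin m) : ℤ :=
  ((Finset.univ.filter fun k => Precedes ε u k i).card : ℤ)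

variable {m : ℕ} {b ε : ℤ} {u : Fin m → ℤ}

theorem Precedes.asymm (hε : 0 ≤ ε) {k i : Fin m} (h : Precedes ε u k i) : ¬ Precedes ε u i k := by
  obtain ⟨h1, h2⟩ := h
  rintro ⟨-, h3⟩
  simp only [stepGap] at h2 h3
  split_ifs at h2 h3 <;> omega

/-- Precedence is comparison of values; for `ε = 0` ties are broken by placing the larger index
first, and for `ε = 1` equal values are incomparable. -/
theorem Precedes.trans (hε : 0 ≤ ε) (hε' : ε ≤ 1) {k l i : Fin m} (h : Precedes ε u k l)
    (h' : Precedes ε u l i) : Precedes ε u k i := by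
  refine ⟨?_, ?_⟩
  · rintro rfl
    exact h.asymm hε h'
  · obtain ⟨h1, h2⟩ := h
    obtain ⟨h3, h4⟩ := h'
    simp only [stepGap] at h2 h4 ⊢
    split_ifs at h2 h4 ⊢ <;> omega

theorem Separated.precedes_or (hb : 0 ≤ b) (h : Separated b ε u) {k i : Fin m} (hne : k ≠ i) :
    Precedes ε u k i ∨ Precedes ε u i k := by
  simp only [Precedes, stepGap]
  rcases lt_or_gt_of_ne hne with hlt | hlt
  · have := h k i hlt
    simp only [hlt, hne, hne.symm, hlt.not_gt, if_true, if_false, ne_eq, not_false_eq_true,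
      true_and]
    omega
  · have := h i k hlt
    simp only [hlt, hne, hne.symm, hlt.not_gt, if_true, if_false, ne_eq, not_false_eq_true,
      true_and]
    omega

theorem separated_iff (hb : 0 ≤ b) (hε : 0 ≤ ε) : Separated b ε u ↔
    (∀ k i, k ≠ i → Precedes ε u k i ∨ Precedes ε u i k) ∧
      ∀ k i, Precedes ε u k i → b + stepGap ε k i ≤ u i - u k := by
  constructor
  · intro h
    refine ⟨fun k i => h.precedes_or hb, fun k i hki => ?_⟩
    obtain ⟨h1, h2⟩ := hki
    simp only [stepGap] at h2 ⊢
    rcases lt_or_gt_of_ne h1 with hlt | hlt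
    · have := h k i hlt
      rw [if_pos hlt] at h2 ⊢
      omega
    · have := h i k hlt
      rw [if_neg hlt.not_gt] at h2 ⊢
      omega
  · rintro ⟨h1, h2⟩ i j hij
    rcases h1 i j hij.ne with h | h
    · have := h2 _ _ h
      rw [stepGap, if_pos hij] at this
      omega
    · have := h2 _ _ h
      rw [stepGap, if_neg hij.not_gt] at this
      omega

theorem rankOf_nonneg (i : Fin m) : 0 ≤ rankOf ε u i := Int.natCast_nonneg _

theorem rankOf_lt (i : Fin m) : rankOf ε u i < m := by
  classical
  rw [rankOf, Nat.cast_lt]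
  calc _ < (Finset.univ : Finset (Fin m)).card :=
        Finset.card_lt_card (Finset.filter_ssubset.2 ⟨i, Finset.mem_univ _, fun h => h.1 rfl⟩)
    _ = m := by simp

theorem rankOf_lt_rankOf (hε : 0 ≤ ε) (hε' : ε ≤ 1) {k i : Fin m} (h : Precedes ε u k i) :
    rankOf ε u k + 1 ≤ rankOf ε u i := by
  classical
  rw [Int.add_one_le_iff, rankOf, rankOf, Nat.cast_lt]
  refine Finset.card_lt_card ((Finset.ssubset_iff_of_subset ?_).2
    ⟨k, by simpa using h, fun hk => (Finset.mem_filter.1 hk).2.1 rfl⟩)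
  intro l hl
  simp only [Finset.mem_filter, Finset.mem_univ, true_and] at hl ⊢
  exact hl.trans hε hε' h

theorem rankOf_of_no_between (hε : 0 ≤ ε) (hε' : ε ≤ 1)
    (ht : ∀ k i, k ≠ i → Precedes ε u k i ∨ Precedes ε u i k) {k i : Fin m}
    (h : Precedes ε u k i) (hno : ∀ l, Precedes ε u k l → ¬ Precedes ε u l i) :
    rankOf ε u i = rankOf ε u k + 1 := by
  classical
  have : (Finset.univ.filter fun l => Precedes ε u l i) =
      insert k (Finset.univ.filter fun l => Precedes ε u l k) := by
    ext l
    simp only [Finset.mem_filter, Finset.mem_univ, true_and, Finset.mem_insert]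
    constructor
    · intro hl
      by_cases hlk : l = k
      · exact .inl hlk
      · exact .inr ((ht l k hlk).resolve_right fun h' => hno l h' hl)
    · rintro (rfl | hl)
      · exact h
      · exact hl.trans hε hε' h
  rw [rankOf, rankOf, this, Finset.card_insert_of_notMem fun hk => (Finset.mem_filter.1 hk).2.1 rfl]
  push_cast
  rfl

/-- Each of the consecutive steps from `k` to `i` in the linear order costs at least `b`, and
`stepGap` is subadditive along the chain. This surplus is what `shrink` may remove without changing
the order. -/
theorem Separated.chain (hb : 0 ≤ b) (hε : 0 ≤ ε) (hε' : ε ≤ 1) (h : Separated b ε u)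
    {k i : Fin m} (hki : Precedes ε u k i) :
    b * (rankOf ε u i - rankOf ε u k) + stepGap ε k i ≤ u i - u k := by
  obtain ⟨ht, hs⟩ := (separated_iff hb hε).1 h
  obtain ⟨N, hN⟩ : ∃ N : ℕ, rankOf ε u i - rankOf ε u k ≤ N := ⟨_, Int.self_le_toNat _⟩
  induction N generalizing k i with
  | zero =>
    have := rankOf_lt_rankOf hε hε' hki
    push_cast at hN
    omega
  | succ N ih =>
    by_cases hno : ∀ l, Precedes ε u k l → ¬ Precedes ε u l i
    · rw [rankOf_of_no_between hε hε' ht hki hno, add_sub_cancel_left, mul_one]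
      exact hs _ _ hki
    · push Not at hno
      obtain ⟨l, hl1, hl2⟩ := hno
      have r1 := rankOf_lt_rankOf hε hε' hl1
      have r2 := rankOf_lt_rankOf hε hε' hl2
      push_cast at hN
      have i1 := ih hl1 (by omega)
      have i2 := ih hl2 (by omega)
      have h3 : stepGap ε k i ≤ stepGap ε k l + stepGap ε l i := by
        simp only [stepGap]
        split_ifs <;> omega
      linarith

theorem precedes_iff_of_imp (hε : 0 ≤ ε) {f : Fin m → ℤ}
    (ht : ∀ k i, k ≠ i → Precedes ε u k i ∨ Precedes ε u i k)
    (h : ∀ k i, Precedes ε u k i → Precedes ε f k i) (k i : Fin m) :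
    Precedes ε f k i ↔ Precedes ε u k i := by
  refine ⟨fun hf => ?_, h k i⟩
  exact (ht k i hf.1).resolve_right fun h' => (h i k h').asymm hε hf

theorem rankOf_congr {f : Fin m → ℤ} (h : ∀ k i, Precedes ε f k i ↔ Precedes ε u k i) :
    rankOf ε f = rankOf ε u := by
  classical
  funext i
  simp only [rankOf, h]

/-- Shrinking a separated family by `b` for every predecessor. -/
noncomputable def shrink (b ε : ℤ) (u : Fin m → ℤ) : Fin m → ℤ := fun i => u i - b * rankOf ε u i

theorem shrink_spec (hb : 0 ≤ b) (hε : 0 ≤ ε) (hε' : ε ≤ 1) (h : Separated b ε u) :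
    Separated 0 ε (shrink b ε u) ∧ rankOf ε (shrink b ε u) = rankOf ε u := by
  obtain ⟨ht, hs⟩ := (separated_iff hb hε).1 h
  have h1 : ∀ k i, Precedes ε u k i → Precedes ε (shrink b ε u) k i := by
    intro k i hki
    have := h.chain hb hε hε' hki
    refine ⟨hki.1, ?_⟩
    simp only [shrink]
    linarith
  have h2 := precedes_iff_of_imp hε ht h1
  refine ⟨(separated_iff le_rfl hε).2 ⟨fun k i hne => ?_, fun k i hki => ?_⟩, rankOf_congr h2⟩
  · simpa only [h2] using ht k i hne
  · rw [zero_add]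
    exact hki.2

/-- Since ranks are preserved in both directions, shrinking by `b` and by `-b` undo each other. -/
theorem expand_spec (hb : 0 ≤ b) (hε : 0 ≤ ε) (hε' : ε ≤ 1) (h : Separated 0 ε u) :
    Separated b ε (shrink (-b) ε u) ∧ rankOf ε (shrink (-b) ε u) = rankOf ε u := by
  obtain ⟨ht, -⟩ := (separated_iff le_rfl hε).1 h
  have h0 : ∀ k i, Precedes ε u k i →
      b + stepGap ε k i ≤ shrink (-b) ε u i - shrink (-b) ε u k := by
    intro k i hki
    have h3 := mul_le_mul_of_nonneg_left (rankOf_lt_rankOf hε hε' hki) hb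
    have h4 := hki.2
    simp only [shrink]
    linarith
  have h1 : ∀ k i, Precedes ε u k i → Precedes ε (shrink (-b) ε u) k i :=
    fun k i hki => ⟨hki.1, by linarith [h0 k i hki]⟩
  have h2 := precedes_iff_of_imp hε ht h1
  refine ⟨(separated_iff hb hε).2 ⟨fun k i hne => ?_, fun k i hki => ?_⟩, rankOf_congr h2⟩
  · simpa only [h2] using ht k i hne
  · exact h0 k i ((h2 k i).1 hki)

theorem exists_first (hε : 0 ≤ ε) (hε' : ε ≤ 1)
    (ht : ∀ k i, k ≠ i → Precedes ε u k i ∨ Precedes ε u i k) (j : Fin m) :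
    ∃ i, ∀ k, k ≠ i → Precedes ε u i k := by
  obtain ⟨i, -, hi⟩ := Finset.exists_min_image Finset.univ (rankOf ε u) ⟨j, Finset.mem_univ _⟩
  refine ⟨i, fun k hk => (ht i k hk.symm).resolve_right fun h => ?_⟩
  have := rankOf_lt_rankOf hε hε' h
  have := hi k (Finset.mem_univ _)
  omega

theorem exists_last (hε : 0 ≤ ε) (hε' : ε ≤ 1)
    (ht : ∀ k i, k ≠ i → Precedes ε u k i ∨ Precedes ε u i k) (j : Fin m) :
    ∃ i, ∀ k, k ≠ i → Precedes ε u k i := by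
  obtain ⟨i, -, hi⟩ := Finset.exists_max_image Finset.univ (rankOf ε u) ⟨j, Finset.mem_univ _⟩
  refine ⟨i, fun k hk => (ht k i hk).resolve_right fun h => ?_⟩
  have := rankOf_lt_rankOf hε hε' h
  have := hi k (Finset.mem_univ _)
  omega

/-- Only the extremes matter: the first index has rank 0 and does not move, the last has rank `m -
1` and loses `b * (m - 1)`. -/
theorem shrink_mem_Ico (hb : 0 ≤ b) (hε : 0 ≤ ε) (hε' : ε ≤ 1) (h : Separated b ε u) {Q : ℤ}
    (hu : ∀ i, 0 ≤ u i ∧ u i < Q + b * (m - 1)) (i : Fin m) :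
    0 ≤ shrink b ε u i ∧ shrink b ε u i < Q := by
  classical
  obtain ⟨ht, hs⟩ := (separated_iff hb hε).1 h
  have hnn : ∀ k i : Fin m, 0 ≤ stepGap ε k i := fun k i => by
    simp only [stepGap]
    split_ifs <;> omega
  constructor
  · obtain ⟨k, hk⟩ := exists_first hε hε' ht i
    have hk0 : rankOf ε u k = 0 := by
      simp only [rankOf, Nat.cast_eq_zero, Finset.card_eq_zero, Finset.filter_eq_empty_iff]
      exact fun l _ hl => hl.asymm hε (hk l hl.1)
    have h1 := (hu k).1
    by_cases hik : i = k
    · simp only [shrink, hik, hk0]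
      linarith
    · have h2 := h.chain hb hε hε' (hk i hik)
      have h3 := hnn k i
      simp only [shrink, hk0] at h2 ⊢
      linarith
  · obtain ⟨k, hk⟩ := exists_last hε hε' ht i
    have hk0 : rankOf ε u k = m - 1 := by
      have : (Finset.univ.filter fun l => Precedes ε u l k) = Finset.univ.erase k := by
        ext l
        simpa using ⟨fun hl => hl.1, hk l⟩
      rw [rankOf, this, Finset.card_erase_of_mem (Finset.mem_univ _), Finset.card_univ,
        Fintype.card_fin, Nat.cast_sub i.pos]
      rfl
    have h1 := (hu k).2
    by_cases hik : i = k
    · simp only [shrink, hik, hk0]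
      linarith
    · have h2 := h.chain hb hε hε' (hk i hik)
      have h3 := hnn i k
      simp only [shrink, hk0] at h2 ⊢
      linarith

theorem expand_mem_Ico (hb : 0 ≤ b) {Q : ℤ}
    (hu : ∀ i, 0 ≤ u i ∧ u i < Q) (i : Fin m) :
    0 ≤ shrink (-b) ε u i ∧ shrink (-b) ε u i < Q + b * (m - 1) := by
  have h1 := mul_le_mul_of_nonneg_left (Int.lt_iff_add_one_le.1 (rankOf_lt (ε := ε) (u := u) i)) hb
  have h2 := mul_nonneg hb (rankOf_nonneg (ε := ε) (u := u) i)
  have := hu i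
  simp only [shrink]
  constructor <;> linarith

theorem card_separated_eq_card_separated_zero (hb : 0 ≤ b) (hε : 0 ≤ ε) (hε' : ε ≤ 1) (Q : ℤ) :
    Nat.card {u : Fin m → ℤ // Separated b ε u ∧ ∀ i, 0 ≤ u i ∧ u i < Q + b * (m - 1)} =
      Nat.card {f : Fin m → ℤ // Separated 0 ε f ∧ ∀ i, 0 ≤ f i ∧ f i < Q} := by
  refine Nat.card_congr
    ⟨fun u => ⟨shrink b ε u, (shrink_spec hb hε hε' u.2.1).1,
        shrink_mem_Ico hb hε hε' u.2.1 u.2.2⟩,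
      fun f => ⟨shrink (-b) ε f, (expand_spec hb hε hε' f.2.1).1, expand_mem_Ico hb f.2.2⟩,
      fun u => ?_, fun f => ?_⟩
  · ext i
    have := congrFun (shrink_spec hb hε hε' u.2.1).2 i
    simp only [shrink] at this ⊢
    rw [this]
    ring
  · ext i
    have := congrFun (expand_spec hb hε hε' f.2.1).2 i
    simp only [shrink] at this ⊢
    rw [this]
    ring

theorem card_separated_zero_zero (Q : ℕ) :
    Nat.card {f : Fin m → ℤ // Separated 0 0 f ∧ ∀ i, 0 ≤ f i ∧ f i < Q} = Q ^ m := by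
  have e : (Fin m → Fin Q) ≃ {f : Fin m → ℤ // Separated 0 0 f ∧ ∀ i, 0 ≤ f i ∧ f i < Q} :=
    { toFun := fun f => ⟨fun i => (f i : ℕ), fun i j _ => by omega, fun i => by simp⟩
      invFun := fun f i => ⟨(f.1 i).toNat, by have := f.2.2 i; omega⟩
      left_inv := fun f => by ext i; simp
      right_inv := fun f => by ext i; simp [(f.2.2 i).1] }
  rw [← Nat.card_congr e]
  simp

theorem card_separated_zero_one (Q : ℕ) :
    Nat.card {f : Fin m → ℤ // Separated 0 1 f ∧ ∀ i, 0 ≤ f i ∧ f i < Q} = Q.descFactorial m := by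
  have e : (Fin m ↪ Fin Q) ≃ {f : Fin m → ℤ // Separated 0 1 f ∧ ∀ i, 0 ≤ f i ∧ f i < Q} :=
    { toFun := fun f => ⟨fun i => (f i : ℕ), fun i j hij => by
          have : (f i : ℕ) ≠ f j := fun h => hij.ne (f.injective (Fin.ext h))
          change (0 : ℤ) + 1 ≤ (f j : ℕ) - (f i : ℕ) ∨ (0 : ℤ) + 1 ≤ (f i : ℕ) - (f j : ℕ)
          omega, fun i => by simp⟩
      invFun := fun f => ⟨fun i => ⟨(f.1 i).toNat, by have := f.2.2 i; omega⟩, fun i j hij => by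
          have h1 := f.2.2 i
          have h2 := f.2.2 j
          have h3 : (f.1 i).toNat = (f.1 j).toNat := congrArg Fin.val hij
          rcases lt_trichotomy i j with h | h | h
          · have := f.2.1 i j h
            omega
          · exact h
          · have := f.2.1 j i h
            omega⟩
      left_inv := fun f => by ext i; simp
      right_inv := fun f => by ext i; exact Int.toNat_of_nonneg (f.2.2 i).1 }
  rw [← Nat.card_congr e]
  simp

/-- For `ε = 0` separation is vacuous, for `ε = 1` it is injectivity. The bound `m ≤ Q` keeps the
falling factorial free of truncated subtraction. -/
theorem card_separated_zero (hε : ε = 0 ∨ ε = 1) (Q : ℕ) (hQ : m ≤ Q) :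
    (Nat.card {f : Fin m → ℤ // Separated 0 ε f ∧ ∀ i, 0 ≤ f i ∧ f i < Q} : ℤ) =
      ∏ i : Fin m, ((Q : ℤ) - i * ε) := by
  rcases hε with rfl | rfl
  · rw [card_separated_zero_zero]
    simp
  · rw [card_separated_zero_one, Nat.descFactorial_eq_prod_range, Finset.prod_range]
    push_cast
    refine Finset.prod_congr rfl fun i _ => ?_
    rw [Nat.cast_sub (by omega), mul_one]

end Count

/-! ### Counting proper labellings modulo `q` -/

section Colorings

theorem card_eq_mul_card_of_translation_invariant {m : ℕ} {G : Type*} [AddGroup G]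
    (P : (Fin (m + 1) → G) → Prop) (hP : ∀ x c, P x → P fun i => x i + c) :
    Nat.card {x // P x} = Nat.card G * Nat.card {x // x (Fin.last m) = 0 ∧ P x} := by
  rw [← Nat.card_prod]
  refine Nat.card_congr
    ⟨fun x => (x.1 (Fin.last m), ⟨fun i => x.1 i + -x.1 (Fin.last m), by simp, hP _ _ x.2⟩),
      fun y => ⟨fun i => y.2.1 i + y.1, hP _ _ y.2.2.2⟩, fun x => ?_, fun y => ?_⟩
  · ext i
    simp
  · obtain ⟨c, x, hx, hx'⟩ := y
    ext i <;> simp [hx]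

theorem forall_intCast_ne_iff {q : ℕ} {b ε d : ℤ} (hb : 0 ≤ b) (hε : 0 ≤ ε) (hbq : b < q) (hεq : b + ε ≤ q)
    (hd : -(q : ℤ) < d) (hd' : d < q) :
    (∀ g : ℤ, 1 - ε - b ≤ g → g ≤ b → (d : ZMod q) ≠ (g : ZMod q)) ↔
      (b + 1 ≤ d ∧ d ≤ q - b - ε) ∨ (b + 1 - q ≤ d ∧ d ≤ -(b + ε)) := by
  constructor
  · intro h
    have h1 : ¬ (1 - ε - b ≤ d ∧ d ≤ b) := fun hg => h d hg.1 hg.2 rfl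
    have h2 : ¬ (1 - ε - b ≤ d + q ∧ d + q ≤ b) := fun hg => h _ hg.1 hg.2 (by simp)
    have h3 : ¬ (1 - ε - b ≤ d - q ∧ d - q ≤ b) := fun hg => h _ hg.1 hg.2 (by simp)
    omega
  · intro h g h1 h2 heq
    rw [ZMod.intCast_eq_intCast_iff_dvd_sub] at heq
    obtain ⟨k, hk⟩ := heq
    have hq : (0 : ℤ) < q := by omega
    -- Both `d` and `g` lie strictly between `-q` and `q`, so only the translates by `0` and `±q`
    -- can collide.
    have hk1 : k < 2 := by
      by_contra! hk2
      nlinarith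
    have hk1' : -2 < k := by
      by_contra! hk2
      nlinarith
    interval_cases k <;> omega

theorem card_normalized_colorings_eq_card_separated {m q : ℕ} {b ε : ℤ} (hb : 0 ≤ b) (hε : 0 ≤ ε)
    (hq : 2 * b + 2 * ε < q) :
    Nat.card {x : Fin (m + 1) → ZMod q // x (Fin.last m) = 0 ∧
        ∀ i j, i < j → ∀ g : ℤ, 1 - ε - b ≤ g → g ≤ b → x j - x i ≠ (g : ZMod q)} =
      Nat.card {u : Fin m → ℤ // Separated b ε u ∧ ∀ i, 0 ≤ u i ∧ u i < q - 2 * b - ε} := by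
  have : NeZero q := ⟨by omega⟩
  have hval : ∀ y : ZMod q, (((y.val : ℤ)) : ZMod q) = y := fun y => by simp
  have hlt : ∀ y : ZMod q, (y.val : ℤ) < q := fun y => by exact_mod_cast ZMod.val_lt y
  have hdiff : ∀ y z : ZMod q, (∀ g : ℤ, 1 - ε - b ≤ g → g ≤ b → z - y ≠ (g : ZMod q)) ↔
      (b + 1 ≤ (z.val : ℤ) - y.val ∧ (z.val : ℤ) - y.val ≤ q - b - ε) ∨
        (b + 1 - q ≤ (z.val : ℤ) - y.val ∧ (z.val : ℤ) - y.val ≤ -(b + ε)) := by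
    intro y z
    have h1 := hlt y
    have h2 := hlt z
    rw [← forall_intCast_ne_iff hb hε (by omega) (by omega) (by omega) (by omega)]
    simp
  have hcast : ∀ t : ℤ, 0 ≤ t → t < q → ((t : ZMod q).val : ℤ) = t := by
    intro t h0 h1
    rw [ZMod.val_intCast, Int.emod_eq_of_lt h0 h1]
  simp only [hdiff]
  -- The conditions against the last label, which is 0, confine each other value to `[b + ε, q - b -
  -- 1]`; the shift moves this to start at 0. Within that range the wrap-around bounds are automatic
  -- and only separation remains.
  refine Nat.card_congr ⟨fun x => ⟨fun i => (x.1 i.castSucc).val - b - ε, ?_, ?_⟩,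
    fun u => ⟨Fin.snoc (fun i => ((u.1 i + b + ε : ℤ) : ZMod q)) 0, ?_, ?_⟩, ?_, ?_⟩
  · intro i j hij
    have h := x.2.2 i.castSucc j.castSucc (Fin.castSucc_lt_castSucc_iff.2 hij)
    dsimp only
    omega
  · intro i
    have h := x.2.2 i.castSucc (Fin.last m) (Fin.castSucc_lt_last i)
    rw [x.2.1, ZMod.val_zero] at h
    dsimp only
    omega
  · exact Fin.snoc_last _ _
  · intro i j hij
    obtain ⟨k, rfl⟩ := Fin.exists_castSucc_eq.2 (Fin.ne_last_of_lt hij)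
    have hk := u.2.2 k
    rw [Fin.snoc_castSucc, hcast _ (by omega) (by omega)]
    induction j using Fin.lastCases with
    | last =>
      rw [Fin.snoc_last, ZMod.val_zero]
      omega
    | cast l =>
      have hl := u.2.2 l
      rw [Fin.snoc_castSucc, hcast _ (by omega) (by omega)]
      have := u.2.1 k l (Fin.castSucc_lt_castSucc_iff.1 hij)
      omega
  · intro x
    ext i
    induction i using Fin.lastCases with
    | last => simp [x.2.1]
    | cast i =>
      simp only [Fin.snoc_castSucc, Int.cast_add, Int.cast_sub, hval]
      ring
  · intro u
    ext i
    have := u.2.2 i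
    simp only [Fin.snoc_castSucc]
    rw [hcast _ (by omega) (by omega)]
    ring

theorem card_normalized_colorings {m q : ℕ} {b ε : ℤ} (hb : 0 ≤ b) (hε : ε = 0 ∨ ε = 1)
    (hq : (b + 1) * (m + 2) + b + 2 * ε < q) :
    (Nat.card {x : Fin (m + 1) → ZMod q // x (Fin.last m) = 0 ∧
        ∀ i j, i < j → ∀ g : ℤ, 1 - ε - b ≤ g → g ≤ b → x j - x i ≠ (g : ZMod q)} : ℤ) =
      ∏ i : Fin m, ((q : ℤ) - (i + 1) * ε - b * (m + 1)) := by
  have hε0 : 0 ≤ ε := by omega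
  have hbm : 0 ≤ b * m := mul_nonneg hb (Int.natCast_nonneg m)
  rw [card_normalized_colorings_eq_card_separated hb hε0 (by linarith)]
  -- `Q` is the interval length `q - 2 * b - ε` less the total shrinkage `b * (m - 1)`.
  obtain ⟨Q, hQ⟩ := Int.eq_ofNat_of_zero_le (a := q - b * (m + 1) - ε) (by linarith)
  have h1 : (q : ℤ) - 2 * b - ε = Q + b * (m - 1) := by
    rw [← hQ]
    ring
  rw [h1, card_separated_eq_card_separated_zero hb hε0 (by omega), card_separated_zero hε _]
  · refine Finset.prod_congr rfl fun i _ => ?_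
    rw [← hQ]
    ring
  · zify
    rw [← hQ]
    linarith

end Colorings

/-! ### The finite field method for gain graphs -/

section GainGraphs

/-- The flats of a finite family of affine subspaces, given by the sets of indices that cut them
out. -/
theorem exists_index_set_of_mem_flats {V E : Type*} [AddCommGroup V] [Module ℝ V] [Fintype E]
    [DecidableEq (AffineSubspace ℝ V)] {h : E → AffineSubspace ℝ V} {z : AffineSubspace ℝ V}
    (hz : z ∈ flats (Finset.univ.image h)) :
    ∃ T : Set E, (∀ p, p ∈ z ↔ ∀ e ∈ T, p ∈ h e) ∧ ∃ p, p ∈ z := by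
  obtain ⟨⟨B, hB, rfl⟩, hne⟩ := mem_flats_iff.1 hz
  obtain ⟨T, -, rfl⟩ := Finset.subset_image_iff.1 hB
  refine ⟨T, fun p => ?_, (AffineSubspace.nonempty_iff_ne_bot _).2 hne⟩
  rw [mem_inf_id_iff]
  simp

theorem eval_characteristicPolynomial_image_eq_card {V E : Type*} [AddCommGroup V] [Module ℝ V]
    [Fintype E] [DecidableEq (AffineSubspace ℝ V)] {h : E → AffineSubspace ℝ V}
    (hh : ∀ e, h e ≠ ⊤) {ι : Type*} [Finite ι] (S : ι → E → Prop) (q : ℕ) (pt : ι → V)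
    (hpt : ∀ x e, pt x ∈ h e ↔ S x e)
    (hcard : ∀ (T : Set E) (z : AffineSubspace ℝ V), (∀ p, p ∈ z ↔ ∀ e ∈ T, p ∈ h e) →
      (∃ p, p ∈ z) → Nat.card {x // ∀ e ∈ T, S x e} = q ^ Module.finrank ℝ z.direction) :
    (characteristicPolynomial (Finset.univ.image h)).eval (q : ℤ) =
      Nat.card {x // ∀ e, ¬ S x e} := by
  rw [eval_characteristicPolynomial_eq_card (by simpa using hh) pt q]
  · simp [hpt]
  · intro z hz
    obtain ⟨T, hT, hne⟩ := exists_index_set_of_mem_flats hz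
    rw [← hcard T z hT hne]
    simp only [hT, hpt]

variable {n : ℕ} {E : Type*} (Φ : IntegralGainGraph (Fin n) E)

/-- The vertex labelling `x` satisfies the equation of the edge `e`. -/
def IntegralGainGraph.Satisfies {R : Type*} [Ring R] (x : Fin n → R) (e : E) : Prop :=
  x (Φ.tgt e) - x (Φ.src e) = (Φ.gain e : R)

theorem IntegralGainGraph.satisfies_intCast_iff {R : Type*} [Ring R] [CharZero R] (θ : Fin n → ℤ)
    (e : E) : Φ.Satisfies (fun i => (θ i : R)) e ↔ Φ.Satisfies θ e := by
  simp only [IntegralGainGraph.Satisfies, Int.cast_id]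
  norm_cast

/-- If `q` is large, the labels of a labelling in `ZMod q` leave a gap on the circle; cutting there
gives an integer labelling that satisfies the same equations. -/
theorem IntegralGainGraph.exists_int_labelling {M q : ℕ} (hM : ∀ e, |Φ.gain e| ≤ M)
    (hq : n * M < q) (x : Fin n → ZMod q) :
    ∃ θ : Fin n → ℤ, ∀ e, Φ.Satisfies θ e ↔ Φ.Satisfies x e := by
  classical
  have : NeZero q := ⟨by omega⟩
  -- The residues `x i - k` with `k < M` number at most `n * M < q`, so some `c` avoids them.
  -- Measured from `c`, labels lie in `[M, q)`; a difference minus a gain is then less than `q` in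
  -- absolute value, so a congruence is an equality.
  obtain ⟨c, hc⟩ : ∃ c : ZMod q, ∀ i, M ≤ (x i - c).val := by
    let S : Finset (ZMod q) :=
      (Finset.univ ×ˢ Finset.range M).image fun p : Fin n × ℕ => x p.1 - (p.2 : ZMod q)
    have hS : S.card < Fintype.card (ZMod q) := by
      refine Finset.card_image_le.trans_lt ?_
      simpa [ZMod.card] using hq
    obtain ⟨c, hc⟩ : ∃ c, c ∉ S := by
      by_contra! h
      exact hS.ne (Finset.card_eq_iff_eq_univ S |>.2 (Finset.eq_univ_of_forall h))
    refine ⟨c, fun i => ?_⟩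
    by_contra! h
    refine hc (Finset.mem_image.2 ⟨(i, (x i - c).val), by simpa using h, ?_⟩)
    simp
  refine ⟨fun i => (x i - c).val, fun e => ?_⟩
  have hcast : (((((x (Φ.tgt e) - c).val : ℤ) - (x (Φ.src e) - c).val : ℤ)) : ZMod q) =
      x (Φ.tgt e) - x (Φ.src e) := by simp
  unfold IntegralGainGraph.Satisfies
  rw [← hcast, ZMod.intCast_eq_intCast_iff_dvd_sub]
  constructor
  · intro h
    simp only [Int.cast_id] at h
    rw [h, sub_self]
    exact dvd_zero _
  · intro h
    have h1 := hc (Φ.tgt e)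
    have h2 := hc (Φ.src e)
    have h3 := ZMod.val_lt (x (Φ.tgt e) - c)
    have h4 := ZMod.val_lt (x (Φ.src e) - c)
    have h5 := abs_le.1 (hM e)
    have := Int.eq_zero_of_abs_lt_dvd h (by rw [abs_lt]; omega)
    simp only [Int.cast_id]
    omega

variable {Φ} (T : Set E)

/-- The adjacency of vertices along the edges in `T`. -/
def IntegralGainGraph.Step (Φ : IntegralGainGraph (Fin n) E) (T : Set E) (i j : Fin n) : Prop :=
  ∃ e ∈ T, Φ.src e = i ∧ Φ.tgt e = j

instance IntegralGainGraph.finite_components : Finite (Quot (Φ.Step T)) :=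
  Finite.of_surjective _ Quot.mk_surjective

/-- Gains are integers, so taking floors preserves the equations. -/
theorem IntegralGainGraph.exists_int_solution {p : Fin n → ℝ} (hp : ∀ e ∈ T, Φ.Satisfies p e) :
    ∃ θ : Fin n → ℤ, ∀ e ∈ T, Φ.Satisfies θ e := by
  refine ⟨fun i => ⌊p i⌋, fun e he => ?_⟩
  have h : p (Φ.tgt e) = p (Φ.src e) + (Φ.gain e : ℤ) := by
    rw [← hp e he]
    ring
  simp only [IntegralGainGraph.Satisfies, Int.cast_id]
  rw [h, Int.floor_add_intCast]
  ring

/-- Subtracting an integral solution leaves a labelling constant on components. Real solvability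
supplies that solution for every modulus. -/
theorem IntegralGainGraph.card_solutions {p : Fin n → ℝ} (hp : ∀ e ∈ T, Φ.Satisfies p e) (q : ℕ) :
    Nat.card {x : Fin n → ZMod q // ∀ e ∈ T, Φ.Satisfies x e} = q ^ Nat.card (Quot (Φ.Step T)) := by
  obtain ⟨θ, hθ⟩ := IntegralGainGraph.exists_int_solution T hp
  have hθ' : ∀ e ∈ T, (θ (Φ.tgt e) : ZMod q) - θ (Φ.src e) = Φ.gain e := fun e he => by
    have := hθ e he
    simp only [IntegralGainGraph.Satisfies, Int.cast_id] at this
    rw [← this]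
    push_cast
    rfl
  have e : {x : Fin n → ZMod q // ∀ e ∈ T, Φ.Satisfies x e} ≃ (Quot (Φ.Step T) → ZMod q) :=
    { toFun := fun x => Quot.lift (fun i => x.1 i - θ i) (by
        rintro _ _ ⟨e, he, rfl, rfl⟩
        have h1 := x.2 e he
        have h2 := hθ' e he
        simp only [IntegralGainGraph.Satisfies] at h1
        linear_combination h2 - h1)
      invFun := fun y => ⟨fun i => y (Quot.mk _ i) + θ i, fun e he => by
        have h1 : Quot.mk (Φ.Step T) (Φ.src e) = Quot.mk _ (Φ.tgt e) :=
          Quot.sound ⟨e, he, rfl, rfl⟩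
        simp only [IntegralGainGraph.Satisfies, h1]
        linear_combination hθ' e he⟩
      left_inv := fun x => by ext i; simp
      right_inv := fun y => by ext ⟨i⟩; simp }
  rw [Nat.card_congr e, Nat.card_fun, Nat.card_zmod]

/-- The labellings that are constant along the edges in `T`. -/
def IntegralGainGraph.constantOn (Φ : IntegralGainGraph (Fin n) E) (T : Set E) :
    Submodule ℝ (Fin n → ℝ) :=
  LinearMap.range (LinearMap.funLeft ℝ ℝ (Quot.mk (Φ.Step T)))

theorem IntegralGainGraph.mem_constantOn_iff {v : Fin n → ℝ} :
    v ∈ Φ.constantOn T ↔ ∀ e ∈ T, v (Φ.tgt e) = v (Φ.src e) := by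
  constructor
  · rintro ⟨y, rfl⟩ e he
    have h1 : Quot.mk (Φ.Step T) (Φ.src e) = Quot.mk _ (Φ.tgt e) :=
      Quot.sound ⟨e, he, rfl, rfl⟩
    simp [LinearMap.funLeft_apply, h1]
  · intro h
    refine ⟨Quot.lift v ?_, funext fun i => rfl⟩
    rintro _ _ ⟨e, he, rfl, rfl⟩
    exact (h e he).symm

theorem IntegralGainGraph.finrank_constantOn :
    Module.finrank ℝ (Φ.constantOn T) = Nat.card (Quot (Φ.Step T)) := by
  have := Fintype.ofFinite (Quot (Φ.Step T))
  rw [IntegralGainGraph.constantOn, LinearMap.finrank_range_of_inj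
    (LinearMap.funLeft_injective_of_surjective _ _ _ Quot.mk_surjective),
    Module.finrank_fintype_fun_eq_card, Nat.card_eq_fintype_card]

theorem IntegralGainGraph.direction_eq_constantOn {z : AffineSubspace ℝ (Fin n → ℝ)}
    (hz : ∀ p, p ∈ z ↔ ∀ e ∈ T, Φ.Satisfies p e) (hne : ∃ p, p ∈ z) :
    z.direction = Φ.constantOn T := by
  obtain ⟨p, hp⟩ := hne
  ext v
  rw [← AffineSubspace.vadd_mem_iff_mem_direction v hp, hz, IntegralGainGraph.mem_constantOn_iff]
  refine forall₂_congr fun e he => ?_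
  have := (hz p).1 hp e he
  simp only [IntegralGainGraph.Satisfies, vadd_eq_add, Pi.add_apply] at this ⊢
  rw [← this]
  constructor <;> intro h <;> linear_combination h

theorem IntegralGainGraph.direction_eq_comap_constantOn {W : Submodule ℝ (Fin n → ℝ)}
    {z : AffineSubspace ℝ W} (hz : ∀ p : W, p ∈ z ↔ ∀ e ∈ T, Φ.Satisfies (p : Fin n → ℝ) e)
    (hne : ∃ p, p ∈ z) : z.direction = (Φ.constantOn T).comap W.subtype := by
  obtain ⟨p, hp⟩ := hne
  ext v
  rw [← AffineSubspace.vadd_mem_iff_mem_direction v hp, hz, Submodule.mem_comap,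
    IntegralGainGraph.mem_constantOn_iff]
  refine forall₂_congr fun e he => ?_
  have := (hz p).1 hp e he
  simp only [IntegralGainGraph.Satisfies, vadd_eq_add, Submodule.coe_add, Pi.add_apply,
    Submodule.subtype_apply] at this ⊢
  rw [← this]
  constructor <;> intro h <;> linear_combination h

/-- The translate of a vector along the diagonal that lies in the hyperplane of sum zero. -/
noncomputable def centered {m : ℕ} (v : Fin (m + 1) → ℝ) : sumZero (m + 1) :=
  ⟨fun i => v i - (∑ j, v j) / (m + 1), by
    change ∑ i, (v i - (∑ j, v j) / (m + 1)) = 0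
    rw [Finset.sum_sub_distrib, Finset.sum_const, Finset.card_univ, Fintype.card_fin, nsmul_eq_mul]
    push_cast
    field_simp
    ring⟩

theorem IntegralGainGraph.satisfies_centered_iff {m : ℕ} {Φ : IntegralGainGraph (Fin (m + 1)) E}
    (v : Fin (m + 1) → ℝ) (e : E) :
    Φ.Satisfies (centered v : Fin (m + 1) → ℝ) e ↔ Φ.Satisfies v e := by
  simp [IntegralGainGraph.Satisfies, centered]

/-- The diagonal lies in `Φ.constantOn T` and is complementary there to the vectors of sum zero. -/
theorem IntegralGainGraph.finrank_comap_constantOn {m : ℕ}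
    {Φ : IntegralGainGraph (Fin (m + 1)) E} (T : Set E) :
    Module.finrank ℝ ((Φ.constantOn T).comap (sumZero (m + 1)).subtype) + 1 =
      Module.finrank ℝ (Φ.constantOn T) := by
  set D := Φ.constantOn T
  set W := sumZero (m + 1)
  have h1 : (1 : Fin (m + 1) → ℝ) ∈ D := (mem_constantOn_iff T).2 fun _ _ => rfl
  have hsup : (W ⊓ D) ⊔ Submodule.span ℝ {1} = D := by
    refine le_antisymm (sup_le inf_le_right (by simpa using h1)) fun v hv => ?_
    have hv' : v = (centered v : Fin (m + 1) → ℝ) + ((∑ j, v j) / (m + 1)) • 1 := by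
      ext i
      simp [centered]
    have hmem := Submodule.smul_mem D ((∑ j, v j) / (m + 1)) h1
    rw [hv']
    refine Submodule.add_mem_sup ⟨(centered v).2, ?_⟩
      (Submodule.smul_mem _ _ (Submodule.mem_span_singleton_self _))
    have : (centered v : Fin (m + 1) → ℝ) = v - ((∑ j, v j) / (m + 1)) • 1 := by
      ext i
      simp [centered]
    rw [this]
    exact D.sub_mem hv hmem
  have hinf : (W ⊓ D) ⊓ Submodule.span ℝ {1} = ⊥ := by
    refine (Submodule.eq_bot_iff _).2 fun v hv => ?_
    obtain ⟨⟨hW, -⟩, hv⟩ := hv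
    obtain ⟨c, rfl⟩ := Submodule.mem_span_singleton.1 hv
    have : ∑ i : Fin (m + 1), (c • (1 : Fin (m + 1) → ℝ)) i = 0 := hW
    simp only [Pi.smul_apply, Pi.one_apply, smul_eq_mul, mul_one, Finset.sum_const,
      Finset.card_univ, Fintype.card_fin, nsmul_eq_mul, mul_eq_zero] at this
    rcases this with h | h
    · exact absurd h (by positivity)
    · simp [h]
  have h2 := Submodule.finrank_sup_add_finrank_inf_eq (W ⊓ D) (Submodule.span ℝ {1})
  rw [hsup, hinf, finrank_bot, add_zero, finrank_span_singleton one_ne_zero] at h2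
  rw [h2, ← Submodule.map_comap_subtype, Submodule.finrank_map_subtype_eq]

theorem gainHyperplane_ne_top (e : E) :
    gainHyperplane (Φ.src e) (Φ.tgt e) (Φ.gain e) ≠ ⊤ := by
  intro h
  have : (Pi.single (Φ.tgt e) ((Φ.gain e : ℝ) + 1) : Fin n → ℝ) ∈
    gainHyperplane (Φ.src e) (Φ.tgt e) (Φ.gain e) := h ▸ AffineSubspace.mem_top _ _ _
  have : (Pi.single (Φ.tgt e) ((Φ.gain e : ℝ) + 1) : Fin n → ℝ) (Φ.tgt e) -
    (Pi.single (Φ.tgt e) ((Φ.gain e : ℝ) + 1) : Fin n → ℝ) (Φ.src e) = Φ.gain e := this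
  simp [Φ.src_ne_tgt e] at this

theorem comap_gainHyperplane_ne_top {m : ℕ} {Φ : IntegralGainGraph (Fin (m + 1)) E} (e : E) :
    (gainHyperplane (Φ.src e) (Φ.tgt e) (Φ.gain e)).comap
      (sumZero (m + 1)).subtype.toAffineMap ≠ ⊤ := by
  intro h
  refine gainHyperplane_ne_top (Φ := Φ) e (eq_top_iff.2 fun v _ => ?_)
  have : centered v ∈ (gainHyperplane (Φ.src e) (Φ.tgt e) (Φ.gain e)).comap
      (sumZero (m + 1)).subtype.toAffineMap := h ▸ AffineSubspace.mem_top _ _ _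
  exact (IntegralGainGraph.satisfies_centered_iff v e).1 this

/-- The finite field method for the arrangement of a gain graph. -/
theorem IntegralGainGraph.eval_characteristicPolynomial [Fintype E] {M q : ℕ}
    (hM : ∀ e, |Φ.gain e| ≤ M) (hq : n * M < q) :
    (characteristicPolynomial Φ.arrangement).eval (q : ℤ) =
      Nat.card {x : Fin n → ZMod q // ∀ e, ¬ Φ.Satisfies x e} := by
  classical
  have : NeZero q := ⟨by omega⟩
  choose θ hθ using Φ.exists_int_labelling hM hq
  have hpt : ∀ x e, (fun i => (θ x i : ℝ)) ∈ gainHyperplane (Φ.src e) (Φ.tgt e) (Φ.gain e) ↔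
      Φ.Satisfies x e := fun x e => (Φ.satisfies_intCast_iff (θ x) e).trans (hθ x e)
  unfold IntegralGainGraph.arrangement
  convert eval_characteristicPolynomial_image_eq_card (gainHyperplane_ne_top (Φ := Φ))
    (fun (x : Fin n → ZMod q) e => Φ.Satisfies x e) q _ hpt ?_
  intro T z hz hne
  have hz' : ∀ p, p ∈ z ↔ ∀ e ∈ T, Φ.Satisfies p e := hz
  rw [direction_eq_constantOn T hz' hne, finrank_constantOn]
  obtain ⟨p, hp⟩ := hne
  exact card_solutions T ((hz' p).1 hp) q

/-- The finite field method for the arrangement that a gain graph induces on the hyperplane of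
sum zero. -/
theorem IntegralGainGraph.eval_characteristicPolynomial_inducedOn [Fintype E] {m M q : ℕ}
    {Φ : IntegralGainGraph (Fin (m + 1)) E} (hM : ∀ e, |Φ.gain e| ≤ M) (hq : (m + 1) * M < q) :
    (characteristicPolynomial (inducedOn (sumZero (m + 1)) Φ.arrangement)).eval (q : ℤ) =
      Nat.card {x : Fin (m + 1) → ZMod q // x (Fin.last m) = 0 ∧ ∀ e, ¬ Φ.Satisfies x e} := by
  classical
  have : NeZero q := ⟨by omega⟩
  choose θ hθ using Φ.exists_int_labelling hM hq
  have hpt : ∀ (x : {x : Fin (m + 1) → ZMod q // x (Fin.last m) = 0}) e,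
      centered (fun i => (θ x i : ℝ)) ∈ (gainHyperplane (Φ.src e) (Φ.tgt e) (Φ.gain e)).comap
        (sumZero (m + 1)).subtype.toAffineMap ↔ Φ.Satisfies x.1 e := fun x e =>
    (satisfies_centered_iff _ e).trans <| (Φ.satisfies_intCast_iff (θ x) e).trans (hθ x e)
  have hsub : ∀ P : (Fin (m + 1) → ZMod q) → Prop,
      Nat.card {x : {x : Fin (m + 1) → ZMod q // x (Fin.last m) = 0} // P x.1} =
        Nat.card {x : Fin (m + 1) → ZMod q // x (Fin.last m) = 0 ∧ P x} := fun P =>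
    Nat.card_congr (Equiv.subtypeSubtypeEquivSubtypeInter _ _)
  unfold inducedOn IntegralGainGraph.arrangement
  rw [Finset.image_image, ← hsub, Function.comp_def]
  convert eval_characteristicPolynomial_image_eq_card (comap_gainHyperplane_ne_top (Φ := Φ))
    (fun (x : {x : Fin (m + 1) → ZMod q // x (Fin.last m) = 0}) e => Φ.Satisfies x.1 e) q _ hpt ?_
  intro T z hz hne
  have hz' : ∀ p : sumZero (m + 1), p ∈ z ↔ ∀ e ∈ T, Φ.Satisfies (p : Fin (m + 1) → ℝ) e := hz
  obtain ⟨p, hp⟩ := id hne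
  rw [hsub fun x => ∀ e ∈ T, Φ.Satisfies x e]
  -- Multiplying by `q` removes the normalization on one side and restores the diagonal dimension on
  -- the other.
  refine Nat.eq_of_mul_eq_mul_left (NeZero.pos q) ?_
  rw [← pow_succ', direction_eq_comap_constantOn T hz' hne, finrank_comap_constantOn,
    finrank_constantOn, ← card_solutions T ((hz' p).1 hp) q,
    card_eq_mul_card_of_translation_invariant (fun x => ∀ e ∈ T, Φ.Satisfies x e), Nat.card_zmod]
  intro x c h e he
  have := h e he
  simp only [IntegralGainGraph.Satisfies] at this ⊢
  rw [← this]
  ring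

end GainGraphs

/-! ### Comparison of the two products -/

section Main

theorem forall_not_satisfies_gainK_iff {n : ℕ} {a b : ℤ} {R : Type*} [Ring R] (x : Fin n → R) :
    (∀ e, ¬ (gainK n a b).Satisfies x e) ↔
      ∀ i j, i < j → ∀ g : ℤ, a ≤ g → g ≤ b → x j - x i ≠ (g : R) :=
  ⟨fun h i j hij g h1 h2 => h (⟨(i, j), hij⟩, ⟨g, h1, h2⟩),
    fun h e => h _ _ e.1.2 _ e.2.2.1 e.2.2.2⟩

theorem card_normalized_colorings_gainK (m q : ℕ) (a b : ℤ) (hab : a + b = 0 ∨ a + b = 1)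
    (hq : (|b| + 1) * (m + 2) + |b| + 2 < q) :
    (Nat.card {x : Fin (m + 1) → ZMod q // x (Fin.last m) = 0 ∧
        ∀ e, ¬ (gainK (m + 1) a b).Satisfies x e} : ℤ) =
      (forestPolynomial (m + 1) (1 - a) b).eval (q : ℤ) := by
  have hq0 : (0 : ℤ) < q := lt_of_le_of_lt (by positivity) hq
  rw [eval_forestPolynomial m q hq0.ne']
  simp only [forall_not_satisfies_gainK_iff]
  rcases le_or_gt 0 b with hb | hb
  · obtain ⟨ε, rfl⟩ : ∃ ε, a = 1 - ε - b := ⟨1 - a - b, by ring⟩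
    have hε : ε = 0 ∨ ε = 1 := by omega
    rw [abs_of_nonneg hb] at hq
    rw [card_normalized_colorings hb hε (by omega), Int.toNat_of_nonneg hb,
      Int.toNat_of_nonneg (by omega)]
    refine Finset.prod_congr rfl fun i _ => ?_
    ring
  -- For `b < 0` also `a > b`: there are no hyperplanes and no weights, and both sides are `q ^ m`.
  · have h1 : (1 - a).toNat = 0 := by omega
    have h2 : b.toNat = 0 := by omega
    have htriv : ∀ x : Fin (m + 1) → ZMod q,
        (∀ i j, i < j → ∀ g : ℤ, a ≤ g → g ≤ b → x j - x i ≠ (g : ZMod q)) ↔ True :=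
      fun x => iff_true_intro fun i j _ g h3 h4 => by omega
    have h := card_eq_mul_card_of_translation_invariant (m := m) (G := ZMod q) (fun _ => True)
      fun _ _ _ => trivial
    have hq' : 0 < q := by exact_mod_cast hq0
    rw [Nat.card_congr (Equiv.subtypeUnivEquiv fun _ => trivial), Nat.card_fun, Nat.card_zmod,
      Nat.card_eq_fintype_card, Fintype.card_fin, pow_succ'] at h
    simp only [htriv]
    rw [← Nat.eq_of_mul_eq_mul_left hq' h, h1, h2]
    simp

theorem abs_gain_gainK_le {n : ℕ} {a b : ℤ} (e) : |(gainK n a b).gain e| ≤ (|a| + |b|).toNat := by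
  have h1 : a ≤ (gainK n a b).gain e := e.2.2.1
  have h2 : (gainK n a b).gain e ≤ b := e.2.2.2
  have h3 := neg_abs_le a
  have h4 := le_abs_self b
  have h5 := abs_nonneg a
  have h6 := abs_nonneg b
  rw [Int.toNat_of_nonneg (by omega), abs_le]
  omega

theorem polynomial_eq_of_eval_large {p r : ℤ[X]} (K : ℕ)
    (h : ∀ q : ℕ, K < q → p.eval (q : ℤ) = r.eval (q : ℤ)) : p = r := by
  refine eq_of_infinite_eval_eq p r (Set.infinite_of_injective_forall_mem
    (f := fun k : ℕ => ((K + 1 + k : ℕ) : ℤ)) (fun k l hkl => ?_) fun k => h _ (by omega))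
  simpa using hkl

theorem mainTheorem5 (n : ℕ) (hn : 1 ≤ n) (a b : ℤ) (hab : a + b = 0 ∨ a + b = 1) :
    characteristicPolynomial (inducedOn (sumZero n) (gainK n a b).arrangement) =
        forestPolynomial n (1 - a) b ∧
      characteristicPolynomial (gainK n a b).arrangement =
        X * forestPolynomial n (1 - a) b := by
  obtain ⟨m, rfl⟩ := Nat.exists_eq_add_of_le' hn
  obtain ⟨K, hK⟩ : ∃ K : ℕ, ∀ q : ℕ, K < q →
      (m + 1) * (|a| + |b|).toNat < q ∧ (|b| + 1) * (m + 2) + |b| + 2 < q :=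
    ⟨(m + 1) * (|a| + |b|).toNat + ((|b| + 1) * (m + 2) + |b| + 2).toNat, fun q hq => by
      have := Int.self_le_toNat ((|b| + 1) * (m + 2) + |b| + 2)
      omega⟩
  constructor
  · refine polynomial_eq_of_eval_large K fun q hq => ?_
    rw [IntegralGainGraph.eval_characteristicPolynomial_inducedOn abs_gain_gainK_le (hK q hq).1,
      card_normalized_colorings_gainK m q a b hab (hK q hq).2]
  · refine polynomial_eq_of_eval_large K fun q hq => ?_
    rw [IntegralGainGraph.eval_characteristicPolynomial abs_gain_gainK_le (hK q hq).1, eval_mul,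
      eval_X, ← card_normalized_colorings_gainK m q a b hab (hK q hq).2,
      card_eq_mul_card_of_translation_invariant
        (fun x => ∀ e, ¬ (gainK (m + 1) a b).Satisfies x e), Nat.card_zmod, Nat.cast_mul]
    intro x c h e he
    refine h e ?_
    simp only [IntegralGainGraph.Satisfies] at he ⊢
    rw [← he]
    ring

end Main
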